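/- Let $k\ge 3$, let $n\ge k+1$ and let $w_1,\dots,w_m\ge 0$ be group weights, not all zero. There are $n$ agents; agent $i$ has a type $\theta_i=(x_i,g_i)$ with a private location $x_i\in\mathbb{R}$ and a public set $g_i\subseteq\{1,\dots,m\}$ of group memberships, and $G_j=\{i : j\in g_i\}$. Let $\Theta=\mathbb{R}\times 2^{\{1,\dots,m\}}$ be the set of types. A deterministic mechanism is a map $f:\Theta^n\to\mathbb{R}^k$ that places $k$ facilities, and the cost of an agent at $x$ under a placement $Y$ is $c(Y,x)=\min_{y\in Y}|y-x|$. The mechanism is - *anonymous* if permuting the types among the agents does not change the set of facility locations; - *strategyproof* if $c(f(\theta),x_i)\le c(f((x_i',g_i),\theta_{-i}),x_i)$ for every profile $\theta\in\Theta^n$, every agent $i$ and every $x_i'\in\mathbb{R}$. For group effects $E_j(\theta,Y)$ put $\mathrm{MGE}(\theta,Y)=\max_{1\le j\le m}E_j(\theta,Y)$. The approximation ratio of $f$ is $$\rho(f)=\sup_{\theta\in\Theta^n}\frac{\mathrm{MGE}(\theta,f(\theta))}{\min_{Y\in\mathbb{R}^k}\mathrm{MGE}(\theta,Y)}\in[0,\infty],$$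 where $a/0=\infty$ for $a>0$, and profiles for which numerator and denominator are both $0$ are disregarded. Then no deterministic, anonymous, strategyproof mechanism $f:\Theta^n\to\mathbb{R}^k$ has $\rho(f)<\infty$ when $E_j(\theta,Y)=w_j\sum_{i\in G_j}c(Y,x_i)$ (weighted total group cost), and none has $\rho(f)<\infty$ when $E_j(\theta,Y)=w_j\max_{i\in G_j}c(Y,x_i)$ (weighted maximum group cost; a maximum over an empty group is $0$). -/

import Mathlib

open scoped ENNReal

noncomputable section

namespace FacilityLocation

/-- The type `(x, g)` of an agent: her private location `x` on the real line and her
public set `g ⊆ [m]` of group memberships. -/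
structure AgentType (m : ℕ) where
  loc : ℝ
  groups : Finset (Fin m)

/-- A type profile of `n` agents. -/
abbrev Profile (n m : ℕ) := Fin n → AgentType m

/-- A placement of `k` facilities on the real line. -/
abbrev Placement (k : ℕ) := Fin k → ℝ

/-- A deterministic mechanism: a map from type profiles to facility placements. -/
abbrev Mechanism (n m k : ℕ) := Profile n m → Placement k

/-- The cost of an agent at `x`: the distance from `x` to the nearest facility. -/
def cost {k : ℕ} (Y : Placement k) (x : ℝ) : ℝ := ⨅ l : Fin k, |Y l - x|

/-- The weighted total group cost `w_j * ∑_{i ∈ G_j} c(Y, x_i)` of group `j`. -/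
def wtgc {n m k : ℕ} (w : Fin m → ℝ) (θ : Profile n m) (Y : Placement k) (j : Fin m) : ℝ :=
  w j * ∑ i : Fin n with j ∈ (θ i).groups, cost Y (θ i).loc

/-- The weighted maximum group cost `w_j * max_{i ∈ G_j} c(Y, x_i)` of group `j`
(it is `0` for a group without members). -/
def wmgc {n m k : ℕ} (w : Fin m → ℝ) (θ : Profile n m) (Y : Placement k) (j : Fin m) : ℝ :=
  w j * ⨆ i : {i : Fin n // j ∈ (θ i).groups}, cost Y (θ i.1).loc

/-- A group effect: it assigns to a profile, a placement and a group the effect `E_j`. -/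
abbrev GroupEffect (n m k : ℕ) := Profile n m → Placement k → Fin m → ℝ

/-- The maximum group effect `max_j E_j`. -/
def mge {n m k : ℕ} (E : GroupEffect n m k) (θ : Profile n m) (Y : Placement k) : ℝ :=
  ⨆ j : Fin m, E θ Y j

/-- The approximation ratio of `f`: the supremum over all profiles of the maximum group effect
of the mechanism divided by the optimal one. It is valued in `[0, ∞]`, where `a / 0 = ∞` for
`a ≠ 0`, and `0 / 0 = 0`, so a profile on which the mechanism and the optimum both have effect `0`
imposes no constraint. -/
def approxRatio {n m k : ℕ} (E : GroupEffect n m k) (f : Mechanism n m k) : ℝ≥0∞ :=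
  ⨆ θ : Profile n m,
    ENNReal.ofReal (mge E θ (f θ)) / ⨅ Y : Placement k, ENNReal.ofReal (mge E θ Y)

/-- Strategyproofness: no agent lowers her cost by misreporting her location, whatever the
reports of the other agents. -/
def Strategyproof {n m k : ℕ} (f : Mechanism n m k) : Prop :=
  ∀ (θ : Profile n m) (i : Fin n) (x' : ℝ),
    cost (f θ) (θ i).loc ≤ cost (f (Function.update θ i ⟨x', (θ i).groups⟩)) (θ i).loc

/-- Anonymity: permuting the agents' types does not change the set of facility locations. -/
def Anonymous {n m k : ℕ} (f : Mechanism n m k) : Prop :=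
  ∀ (θ : Profile n m) (σ : Equiv.Perm (Fin n)), Set.range (f (θ ∘ σ)) = Set.range (f θ)

end FacilityLocation

end

/-! If every agent belongs to every group, both effects agree with the maximum cost up to constant
factors. A finite ratio therefore yields an anonymous strategyproof rule serving every agent within
`ρ` times the optimal maximum cost (`BoundedRule`), and such a rule cannot exist. With all other
reports fixed, an agent is served at the nearest point of a closed set, her image set. Near an end
of a hole of that set she is served exactly at that end, and a second agent can move onto that
facility without losing it. These moves create facilities which, together with those that
approximation forces elsewhere, exceed the number available. Put `k - 3` agents at remote places, so
that the others share three facilities: agents `a < b < c` and a cluster at `t > c`. When `b, c` are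
close compared with their distances to `a` and `t` (a tight pair), they get a single facility, and
it lies in `[b, c]`. If `t` is very far, three agents share two facilities, and the pair cannot be
served at `b` (`ThreeAgents.not_left_mem`). An infimum argument removes the assumption on `t`
(`ThreeAndOne.not_left_mem`), so the facility is at `c` (`ThreeAndOne.right_mem`). This preference
for the right end contradicts itself. The facility at `c` survives when cluster agents move from `t`
to `c` until one is left at `t`. A hole in the image set of `b` then has a left end `l` at which `b`
is served. Moving the last agent from `t` to `l` gives a tight pair `l, b`, with the cluster now at
`c`, served at its left end (`not_boundedRule`). -/

namespace FacilityLocation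

/-! ### One agent: image sets and holes -/

/-- The set of facilities as a function of the report of one agent, the other reports being fixed:
it is finite and nonempty, and the agent cannot profit from a false report. -/
structure Responsive (Φ : ℝ → Set ℝ) : Prop where
  finite : ∀ x, (Φ x).Finite
  nonempty : ∀ x, (Φ x).Nonempty
  sp : ∀ x x', ∀ w ∈ Φ x', ∃ v ∈ Φ x, |v - x| ≤ |w - x|

namespace Responsive

variable {Φ : ℝ → Set ℝ}

/-- An agent standing at `z` could report `x` and have cost `0`, so truth must also give cost `0`.
Thus `{z | z ∈ Φ z}` is exactly the set of attainable facilities. -/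
theorem mem_self (h : Responsive Φ) {x z : ℝ} (hz : z ∈ Φ x) : z ∈ Φ z := by
  obtain ⟨v, hv, hvz⟩ := h.sp z x z hz
  have : v = z := by
    simpa [sub_eq_zero] using hvz
  exact this ▸ hv

theorem exists_nearest (h : Responsive Φ) (x : ℝ) :
    ∃ v ∈ Φ x, v ∈ Φ v ∧ ∀ z ∈ Φ z, |v - x| ≤ |z - x| := by
  obtain ⟨v, hv, hmin⟩ := Set.exists_min_image (Φ x) (fun v => |v - x|) (h.finite x) (h.nonempty x)
  refine ⟨v, hv, h.mem_self hv, fun z hz => ?_⟩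
  obtain ⟨u, hu, huz⟩ := h.sp x z z hz
  exact (hmin u hu).trans huz

theorem isClosed_image (h : Responsive Φ) : IsClosed {z | z ∈ Φ z} := by
  refine isClosed_of_closure_subset fun x hx => ?_
  obtain ⟨v, hv, -, hmin⟩ := h.exists_nearest x
  by_contra hne
  have hvx : v ≠ x := fun e => hne (e ▸ hv)
  have hpos : 0 < |v - x| := abs_pos.2 (sub_ne_zero.2 hvx)
  obtain ⟨z, hz, hzx⟩ := Metric.mem_closure_iff.1 hx _ hpos
  rw [dist_comm, Real.dist_eq] at hzx
  exact absurd (hmin z hz) (not_le.2 hzx)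

/-- A point outside the image set that lies between two image points lies in a hole of the image
set, and an agent in a hole is served by the nearer end of the hole. -/
theorem exists_hole (h : Responsive Φ) {u v w : ℝ} (hu : u ∈ Φ u) (hw : w ∈ Φ w) (hv : v ∉ Φ v)
    (huv : u ≤ v) (hvw : v ≤ w) :
    ∃ l r, u ≤ l ∧ l < v ∧ v < r ∧ r ≤ w ∧ (∀ z, l < z → z < r → z ∉ Φ z) ∧
      (∀ x, l < x → 2 * x < l + r → l ∈ Φ x) ∧ (∀ x, x < r → l + r < 2 * x → r ∈ Φ x) := by
  have hc := h.isClosed_image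
  obtain ⟨l, ⟨hlI, hul, hlv⟩, hl⟩ :=
    (isCompact_Icc.inter_left hc : IsCompact ({z | z ∈ Φ z} ∩ Set.Icc u v)).exists_isGreatest
      ⟨u, hu, le_rfl, huv⟩
  obtain ⟨r, ⟨hrI, hvr, hrw⟩, hr⟩ :=
    (isCompact_Icc.inter_left hc : IsCompact ({z | z ∈ Φ z} ∩ Set.Icc v w)).exists_isLeast
      ⟨w, hw, hvw, le_rfl⟩
  have hlv' : l < v := lt_of_le_of_ne hlv fun e => hv (e ▸ hlI)
  have hvr' : v < r := lt_of_le_of_ne hvr fun e => hv (e ▸ hrI)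
  have hhole : ∀ z, l < z → z < r → z ∉ Φ z := by
    intro z hlz hzr hz
    rcases le_total z v with hzv | hzv
    · exact absurd (hl ⟨hz, by linarith, hzv⟩) (not_le.2 hlz)
    · exact absurd (hr ⟨hz, hzv, by linarith⟩) (not_le.2 hzr)
  refine ⟨l, r, hul, hlv', hvr', hrw, hhole, fun x hlx hx => ?_, fun x hxr hx => ?_⟩
  · obtain ⟨y, hy, hyI, hmin⟩ := h.exists_nearest x
    have h1 := hmin l hlI
    rw [abs_of_neg (sub_neg.2 hlx), abs_le] at h1
    have : y = l := by
      rcases lt_trichotomy y l with hlt | heq | hgt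
      · linarith
      · exact heq
      · exact absurd hyI (hhole y hgt (by linarith))
    exact this ▸ hy
  · obtain ⟨y, hy, hyI, hmin⟩ := h.exists_nearest x
    have h1 := hmin r hrI
    rw [abs_of_pos (sub_pos.2 hxr), abs_le] at h1
    have : y = r := by
      rcases lt_trichotomy y r with hlt | heq | hgt
      · exact absurd hyI (hhole y (by linarith) hlt)
      · exact heq
      · linarith
    exact this ▸ hy

end Responsive

/-! ### Two agents: tight pairs -/

/-- The facilities as a function of the reports of a pair of interchangeable agents. For a tight
pair `τ x y` there is room for one facility only near the pair. -/
structure PairMech (P : ℝ → ℝ → Set ℝ) (τ : ℝ → ℝ → Prop) : Prop where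
  symm : ∀ x y, P x y = P y x
  resp : ∀ y, Responsive fun x => P x y
  diag : ∀ x, x ∈ P x x
  mono : ∀ {x y x' y'}, τ x y → x ≤ x' → x' < y' → y' ≤ y → τ x' y'
  uniq : ∀ {x y u v}, τ x y → x < y → u ∈ P x y → v ∈ P x y → x - (y - x) ≤ u →
    u ≤ y + (y - x) → x - (y - x) ≤ v → v ≤ y + (y - x) → u = v

namespace PairMech

variable {P : ℝ → ℝ → Set ℝ} {τ : ℝ → ℝ → Prop}

theorem resp_right (h : PairMech P τ) (x : ℝ) : Responsive fun y => P x y := by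
  have := h.resp x
  simpa only [h.symm _ x] using this

/-- Each agent could join the other and be served there, so each has a facility within `y - x`. By
`uniq` these two facilities coincide, hence lie between the agents. -/
theorem exists_mem_Icc (h : PairMech P τ) {x y : ℝ} (hxy : x < y) (ht : τ x y) :
    ∃ v ∈ P x y, x ≤ v ∧ v ≤ y := by
  obtain ⟨v, hv, hv'⟩ := (h.resp y).sp x y y (h.diag y)
  obtain ⟨u, hu, hu'⟩ := (h.resp_right x).sp y x x (h.diag x)
  rw [abs_of_pos (by linarith : 0 < y - x), abs_le] at hv'
  rw [abs_of_neg (by linarith : x - y < 0), abs_le] at hu'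
  have := h.uniq ht hxy hu hv (by linarith) (by linarith) (by linarith) (by linarith)
  exact ⟨v, hv, by linarith, by linarith⟩

/-- Whether a tight pair is served at its left end does not depend on its right end. -/
theorem left_mem_of_left_mem (h : PairMech P τ) {x c d : ℝ} (hxc : x < c) (hc : τ x c)
    (hxd : x < d) (hd : τ x d) (hx : x ∈ P x c) : x ∈ P x d := by
  obtain ⟨y, hy, hxy, hyd⟩ := h.exists_mem_Icc hxd hd
  rcases hxy.eq_or_lt with rfl | hxy
  · exact hy
  exfalso
  have hyI : y ∈ P x y := (h.resp_right x).mem_self hy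
  -- Either an agent at `c` can obtain `y`, which forces a second facility besides `x` near the pair
  -- `x, c`, or `c` lies in a hole whose right end `r` serves an agent `d' < r`, outside `[x, d']`.
  rcases le_or_gt y c with hyc | hcy
  · obtain ⟨v, hv, hvc⟩ := (h.resp_right x).sp c y y hyI
    rw [abs_of_nonpos (by linarith : y - c ≤ 0), abs_le] at hvc
    have := h.uniq hc hxc hx hv (by linarith) (by linarith) (by linarith) (by linarith)
    linarith
  · have hcI : c ∉ P x c := fun hcc => by
      have := h.uniq hc hxc hx hcc (by linarith) (by linarith) (by linarith) (by linarith)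
      linarith
    have hxI : x ∈ P x x := h.diag x
    obtain ⟨l, r, hl, hlc, hcr, hry, -, -, hR⟩ :=
      (h.resp_right x).exists_hole hxI hyI hcI hxc.le hcy.le
    obtain ⟨d', hd', hd'r⟩ := exists_between (max_lt hcr (by linarith : (l + r) / 2 < r))
    rw [max_lt_iff] at hd'
    have hr := hR d' hd'r (by linarith)
    have ht' : τ x d' := h.mono hd le_rfl (by linarith) (by linarith)
    obtain ⟨z, hz, hxz, hzd⟩ := h.exists_mem_Icc (by linarith) ht'
    have := h.uniq ht' (by linarith) hr hz (by linarith) (by linarith) (by linarith) (by linarith)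
    linarith

/-- If a tight pair is served at its left end, it is still so when its left end moves right. -/
theorem left_mem_of_le (h : PairMech P τ) {x x' d : ℝ} (ht : τ x d)
    (hx : x ∈ P x d) (hxx' : x ≤ x') (hx'd : x' < d) : x' ∈ P x' d := by
  by_contra hx'
  obtain ⟨l, r, hl, hlx, hxr, hrd, -, hL, -⟩ :=
    (h.resp d).exists_hole hx (h.diag d) hx' hxx' hx'd.le
  obtain ⟨z, hlz, hz⟩ := exists_between (by linarith : l < (l + r) / 2)
  have hlz' := hL z hlz (by linarith)
  have ht' : τ z d := h.mono ht (by linarith) (by linarith) le_rfl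
  obtain ⟨y, hy, hzy, hyd⟩ := h.exists_mem_Icc (by linarith) ht'
  have := h.uniq ht' (by linarith) hlz' hy (by linarith) (by linarith) (by linarith) (by linarith)
  linarith

end PairMech

/-! ### Three agents sharing two facilities -/

/-- Three interchangeable agents which, as long as they stay in the window `[-S, S]`, have to share
two facilities. -/
structure ThreeAgents (G : ℝ → ℝ → ℝ → Set ℝ) (ρ S : ℝ) : Prop where
  one_le : 1 ≤ ρ
  swap₁₂ : ∀ x y z, G x y z = G y x z
  swap₂₃ : ∀ x y z, G x y z = G x z y
  resp : ∀ y z, Responsive fun x => G x y z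
  near_pair : ∀ x y z, ∃ v ∈ G x y z, |v - x| ≤ ρ * |y - z|
  near_self : ∀ x z, x ∈ G x x z
  two : ∀ x y z u v w, |x| ≤ S → |y| ≤ S → |z| ≤ S → u ∈ G x y z → v ∈ G x y z → w ∈ G x y z →
    |u| ≤ 3 * S → |v| ≤ 3 * S → |w| ≤ 3 * S → u < v → v < w → False

namespace ThreeAgents

variable {G : ℝ → ℝ → ℝ → Set ℝ} {ρ S : ℝ}

theorem resp₂ (h : ThreeAgents G ρ S) (x z : ℝ) : Responsive fun y => G x y z := by
  have := h.resp x z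
  simpa only [h.swap₁₂ _ x] using this

theorem resp₃ (h : ThreeAgents G ρ S) (x y : ℝ) : Responsive fun z => G x y z := by
  have := h.resp₂ x y
  simpa only [h.swap₂₃ x _ y] using this

theorem reflect (h : ThreeAgents G ρ S) :
    ThreeAgents (fun x y z => {v | -v ∈ G (-x) (-y) (-z)}) ρ S where
  one_le := h.one_le
  swap₁₂ x y z := by rw [h.swap₁₂]
  swap₂₃ x y z := by rw [h.swap₂₃]
  resp y z := by
    refine ⟨fun x => ?_, fun x => ?_, fun x x' w hw => ?_⟩
    · exact ((h.resp (-y) (-z)).finite (-x)).preimage neg_injective.injOn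
    · obtain ⟨v, hv⟩ := (h.resp (-y) (-z)).nonempty (-x)
      exact ⟨-v, by simpa using hv⟩
    · obtain ⟨v, hv, hvw⟩ := (h.resp (-y) (-z)).sp (-x) (-x') (-w) hw
      refine ⟨-v, by simpa using hv, ?_⟩
      rw [← abs_neg, ← abs_neg (w - x)]
      convert hvw using 2 <;> ring
  near_pair x y z := by
    obtain ⟨v, hv, hvx⟩ := h.near_pair (-x) (-y) (-z)
    refine ⟨-v, by simpa using hv, ?_⟩
    rw [← abs_neg, ← abs_neg (y - z)]
    convert hvx using 2
    · ring
    · congr 1; ring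
  near_self x z := h.near_self (-x) (-z)
  two x y z u v w hx hy hz hu hv hw hu' hv' hw' huv hvw :=
    h.two (-x) (-y) (-z) (-w) (-v) (-u) (by simpa) (by simpa) (by simpa) hw hv hu (by simpa)
      (by simpa) (by simpa) (by linarith) (by linarith)

/-- Two distinct facilities leave no room for an agent that is far away from both. -/
theorem eq_of_far (h : ThreeAgents G ρ S) {a x y u v : ℝ} (ha : |a| ≤ S) (hx : |x| ≤ S)
    (hy : |y| ≤ S) (hxy : ρ * |x - y| ≤ 2 * S) (hu : u ∈ G a x y) (hv : v ∈ G a x y)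
    (hu' : |u| ≤ 3 * S) (hv' : |v| ≤ 3 * S) (hau : ρ * |x - y| < |u - a|)
    (hav : ρ * |x - y| < |v - a|) : u = v := by
  obtain ⟨w, hw, hwa⟩ := h.near_pair a x y
  have hwu : w ≠ u := by rintro rfl; linarith
  have hwv : w ≠ v := by rintro rfl; linarith
  have hw' : |w| ≤ 3 * S := by
    have := abs_add_le (w - a) a
    rw [sub_add_cancel] at this
    linarith
  by_contra huv
  have T := h.two a x y
  rcases lt_or_gt_of_ne huv with h1 | h1 <;> rcases lt_or_gt_of_ne hwu with h2 | h2 <;>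
    rcases lt_or_gt_of_ne hwv with h3 | h3
  all_goals first
    | linarith
    | exact T w u v ha hx hy hw hu hv hw' hu' hv' h2 h1
    | exact T u w v ha hx hy hu hw hv hu' hw' hv' h2 h3
    | exact T u v w ha hx hy hu hv hw hu' hv' hw' h1 h3
    | exact T w v u ha hx hy hw hv hu hw' hv' hu' h3 h1
    | exact T v w u ha hx hy hv hw hu hv' hw' hu' h3 h2
    | exact T v u w ha hx hy hv hu hw hv' hu' hw' h1 h2

/-- Approximation puts a facility within `ρ * (y - x)` of `a`. The factor `ρ + 2` keeps it away from
the pair's interval enlarged by `y - x` on both sides, leaving one facility there. -/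
theorem pairMech (h : ThreeAgents G ρ S) {a : ℝ} (ha : -S ≤ a) :
    PairMech (G a) fun x y => (ρ + 2) * (y - x) < x - a ∧ y ≤ S where
  symm := h.swap₂₃ a
  resp y := h.resp₂ a y
  diag x := by
    rw [h.swap₁₂, h.swap₂₃]
    exact h.near_self x a
  mono := by
    rintro x y x' y' ⟨h1, h2⟩ hx hxy hy
    have := h.one_le
    exact ⟨by nlinarith, by linarith⟩
  uniq := by
    rintro x y u v ⟨h1, h2⟩ hxy hu hv hu1 hu2 hv1 hv2
    have hρ := h.one_le
    have h3 : 0 < ρ * (y - x) := by nlinarith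
    have h4 : ρ * |x - y| = ρ * (y - x) := by rw [abs_sub_comm, abs_of_pos (by linarith)]
    refine h.eq_of_far (a := a) (abs_le.2 ⟨?_, ?_⟩) (abs_le.2 ⟨?_, ?_⟩) (abs_le.2 ⟨?_, ?_⟩) ?_ hu hv
      (abs_le.2 ⟨?_, ?_⟩) (abs_le.2 ⟨?_, ?_⟩) ?_ ?_
    any_goals linarith
    · rw [h4, abs_of_pos] <;> linarith
    · rw [h4, abs_of_pos] <;> linarith

/-- If one tight pair is served at its left end, so are all tight pairs on its right. -/
theorem left_mem_of_tight (h : ThreeAgents G ρ S) {a p c : ℝ} (ha : -S ≤ a) (hpc : p < c)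
    (ht : (ρ + 2) * (c - p) < p - a) (hc : c ≤ S) (hp : p ∈ G a p c) {x d : ℝ} (hpx : p ≤ x)
    (hxd : x < d) (hd : (ρ + 2) * (d - x) < x - a) (hdS : d ≤ S) : x ∈ G a x d := by
  have hP := h.pairMech ha
  have hρ := h.one_le
  have hpa : 0 < p - a := by nlinarith
  -- Step length chosen so that every pair of length at most `3 * s / 2` to the right of `p` is
  -- tight; the left end then advances by steps of at most `s`.
  set s : ℝ := (p - a) / (2 * (ρ + 2)) with hs
  have hs0 : 0 < s := by positivity
  have hsK : (ρ + 2) * s = (p - a) / 2 := by rw [hs]; field_simp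
  have key : ∀ N : ℕ, ∀ x, p ≤ x → x ≤ p + N * s → ∀ d, x < d → (ρ + 2) * (d - x) < x - a →
      d ≤ S → x ∈ G a x d := by
    intro N
    induction N with
    | zero =>
      intro x hpx hx d hxd hd hdS
      obtain rfl : x = p := by
        push_cast at hx; linarith
      exact hP.left_mem_of_left_mem hpc ⟨ht, hc⟩ hxd ⟨hd, hdS⟩ hp
    | succ N ih =>
      intro x hpx hx d hxd hd hdS
      push_cast at hx
      obtain ⟨x₀, hpx₀, hx₀x, hxx₀, hx₀⟩ : ∃ x₀, p ≤ x₀ ∧ x₀ ≤ x ∧ x ≤ x₀ + s ∧ x₀ ≤ p + N * s := by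
        have : 0 ≤ N * s := by positivity
        rcases le_total p (x - s) with h1 | h1
        · exact ⟨x - s, h1, by linarith, by linarith, by linarith⟩
        · exact ⟨p, le_rfl, hpx, by linarith, by linarith⟩
      obtain ⟨d₀, hxd₀, hd₀d, hd₀⟩ : ∃ d₀, x < d₀ ∧ d₀ ≤ d ∧ d₀ ≤ x + s / 2 := by
        rcases le_total d (x + s / 2) with h1 | h1
        · exact ⟨d, hxd, le_rfl, h1⟩
        · exact ⟨x + s / 2, by linarith, h1, le_rfl⟩
      have ht₀ : (ρ + 2) * (d₀ - x₀) < x₀ - a := by nlinarith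
      have h1 := ih x₀ hpx₀ hx₀ d₀ (by linarith) ht₀ (by linarith)
      have h2 := hP.left_mem_of_le ⟨ht₀, by linarith⟩ h1 hx₀x hxd₀
      exact hP.left_mem_of_left_mem hxd₀ ⟨by nlinarith, by linarith⟩ hxd ⟨hd, hdS⟩ h2
  obtain ⟨N, hN⟩ := exists_nat_ge ((x - p) / s)
  rw [div_le_iff₀ hs0] at hN
  exact key N x hpx (by linarith) d hxd hd hdS

/-- If one tight pair is served at its left end, then to the right of it the middle agent is always
served. -/
theorem mid_mem (h : ThreeAgents G ρ S) {a p c : ℝ} (ha : -S ≤ a) (hpc : p < c)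
    (ht : (ρ + 2) * (c - p) < p - a) (hc : c ≤ S) (hp : p ∈ G a p c) {x d : ℝ} (hpx : p ≤ x)
    (hxd : x ≤ d) (hdS : d ≤ S) : x ∈ G a x d := by
  have hP := h.pairMech ha
  have hρ := h.one_le
  have hpa : 0 < p - a := by nlinarith
  by_contra hx
  obtain ⟨l, r, hl, hlx, hxr, hrd, -, -, hR⟩ :=
    (hP.resp d).exists_hole (h.near_self a d) (hP.diag d) hx (by linarith) hxd
  have hs0 : 0 < (p - a) / (2 * (ρ + 2)) := by positivity
  -- An agent `z` just left of the hole's right end `r` is served at `r`. Moving `d` to `r` gives a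
  -- tight pair `z, r` served at both ends.
  obtain ⟨z, hz, hzr⟩ := exists_between
    (max_lt (max_lt hxr (by linarith : (l + r) / 2 < r)) (sub_lt_self r hs0))
  rw [max_lt_iff, max_lt_iff] at hz
  obtain ⟨⟨hz1, hz2⟩, hz3⟩ := hz
  have hrz : r ∈ G a z r := (h.resp₃ a z).mem_self (hR z hzr (by linarith))
  have hτ : (ρ + 2) * (r - z) < z - a := by
    have : (ρ + 2) * ((p - a) / (2 * (ρ + 2))) = (p - a) / 2 := by field_simp
    nlinarith
  have hzz := h.left_mem_of_tight ha hpc ht hc hp (by linarith) hzr hτ (by linarith)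
  have := hP.uniq ⟨hτ, by linarith⟩ hzr hrz hzz (by linarith) (by linarith) (by linarith)
    (by linarith)
  linarith

/-- The mirror image of `mid_mem`. -/
theorem mid_mem' (h : ThreeAgents G ρ S) {a p c : ℝ} (ha : a ≤ S) (hpc : c < p)
    (ht : (ρ + 2) * (p - c) < a - p) (hc : -S ≤ c) (hp : p ∈ G a p c) {x d : ℝ} (hpx : x ≤ p)
    (hxd : d ≤ x) (hdS : -S ≤ d) : x ∈ G a x d := by
  have := h.reflect.mid_mem (a := -a) (p := -p) (c := -c) (x := -x) (d := -d) (by linarith)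
    (by linarith) (by linarith) (by linarith) (by simpa using hp) (by linarith) (by linarith)
    (by linarith)
  simpa using this

/-- A tight pair in a large window is not served at the end next to the third agent. -/
theorem not_left_mem (h : ThreeAgents G ρ S) {p c : ℝ} (hp0 : 0 < p) (hpc : p < c)
    (ht : (ρ + 2) * (c - p) < p) (hS : 2 * (ρ + 4) ^ 3 * p ≤ S) : p ∉ G 0 p c := by
  intro hp
  have hρ := h.one_le
  -- Scales `p`, `X`, `d` grow by the factor `ρ + 4`, so that `p, 0` is tight as seen from `X`, and
  -- `X, 0` as seen from `d`.
  set X : ℝ := (ρ + 4) * p with hX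
  set d : ℝ := (ρ + 4) * X with hd
  have hpX : 5 * p ≤ X := by rw [hX]; nlinarith
  have hXd : 5 * X ≤ d := by rw [hd]; nlinarith
  have hdS : 2 * (ρ + 4) * d ≤ S := by rw [hd, hX]; linarith [hS]
  have hdS' : 10 * d ≤ S := by nlinarith
  have h1 : ∀ {x d}, p ≤ x → x ≤ d → d ≤ S → x ∈ G 0 x d :=
    h.mid_mem (by linarith) hpc (by linarith) (by nlinarith) hp
  -- The middle agent `x` of `0, x, d` is served. Seen from `d`, the pair `0, x` is tight and served
  -- at its near end, so the mirror image applies.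
  have h2 : ∀ {x d}, p ≤ x → (ρ + 2) * x < d - x → d ≤ S → ∀ {b x'}, x' ≤ x → b ≤ x' → -S ≤ b →
      x' ∈ G d x' b := by
    intro x d hpx hxd hdS b x' hx' hb hbS
    have h3 : x ∈ G d x 0 := by
      rw [h.swap₂₃, h.swap₁₂, h.swap₂₃]
      exact h1 hpx (by nlinarith) hdS
    exact h.mid_mem' hdS (by linarith) (by linarith) (by linarith) h3 hx' hb hbS
  have hX2 : ∀ {b x'}, x' ≤ p → b ≤ x' → -S ≤ b → x' ∈ G X x' b :=
    h2 le_rfl (by rw [hX]; linarith) (by linarith)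
  have hd2 : ∀ {b x'}, x' ≤ X → b ≤ x' → -S ≤ b → x' ∈ G d x' b :=
    h2 (by linarith) (by rw [hd]; linarith) (by linarith)
  have hΦ := h.resp X d
  have hXI : X ∈ G X X d := h.near_self X d
  have hXd0 : ρ * |X - d| ≤ ρ * d := by
    rw [abs_sub_comm, abs_of_pos (by linarith)]
    nlinarith
  -- A report this far left forces an image point left of `0`; with `X` on the other side, the point
  -- `0` lies in a hole.
  obtain ⟨v, hv, hvb⟩ := h.near_pair (-(ρ * d + p)) X d
  rw [abs_le] at hvb
  have hvI : v ∈ G v X d := hΦ.mem_self hv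
  have h0 : (0 : ℝ) ∉ G 0 X d := by
    intro h0
    have hX0 : X ∈ G d X 0 := hd2 le_rfl (by linarith) (by linarith)
    have h0' : (0 : ℝ) ∈ G d X 0 := by
      rwa [h.swap₂₃, h.swap₁₂, h.swap₂₃]
    have hab : |X - 0| = X := by rw [sub_zero, abs_of_pos (by linarith)]
    have := h.eq_of_far (abs_le.2 ⟨by linarith, by linarith⟩) (abs_le.2 ⟨by linarith, by linarith⟩)
      (abs_le.2 ⟨by linarith, by linarith⟩) (by rw [hab]; nlinarith) hX0 h0'
      (abs_le.2 ⟨by linarith, by linarith⟩) (abs_le.2 ⟨by linarith, by linarith⟩)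
      (by rw [hab, abs_sub_comm, abs_of_pos (by linarith), hd]; linarith)
      (by rw [hab, abs_sub_comm, abs_of_pos (by linarith), hd]; linarith)
    linarith
  obtain ⟨l, r, hvl, hl0, h0r, hrX, -, hL, -⟩ :=
    hΦ.exists_hole hvI hXI h0 (by linarith) (by linarith)
  have hlS : -S ≤ l := by nlinarith
  -- An agent `b` just right of `l` is served at `l`. After `d` moves to `l`, both `b` and `l` are
  -- served, which leaves nothing for `X`.
  obtain ⟨b, hlb, hb⟩ := exists_between
    (lt_min (by linarith : l < l + p) (by linarith : l < (l + r) / 2))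
  rw [lt_min_iff] at hb
  have hlX : l ∈ G X b l := by
    rw [h.swap₁₂]
    exact (h.resp₃ b X).mem_self (hL b hlb (by linarith))
  have hbX : b ∈ G X b l := hX2 (by linarith) hlb.le hlS
  have hab : |b - l| = b - l := abs_of_pos (by linarith)
  have hbl : ρ * (b - l) ≤ ρ * p := by nlinarith
  have hXp : X = ρ * p + 4 * p := by rw [hX]; ring
  have := h.eq_of_far (abs_le.2 ⟨by linarith, by linarith⟩) (abs_le.2 ⟨by linarith, by linarith⟩)
    (abs_le.2 ⟨by linarith, by linarith⟩) (by rw [hab]; linarith) hlX hbX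
    (abs_le.2 ⟨by linarith, by linarith⟩) (abs_le.2 ⟨by linarith, by linarith⟩)
    (by rw [hab, abs_sub_comm, abs_of_pos (by linarith)]; linarith)
    (by rw [hab, abs_sub_comm, abs_of_pos (by linarith)]; linarith)
  linarith

end ThreeAgents

/-! ### Three agents and a fourth location -/

/-- Three interchangeable agents `x, y, z` and a fourth location `t` which, as long as they stay in
the window `[-9S, 9S]`, have to share three facilities. -/
structure ThreeAndOne (F : ℝ → ℝ → ℝ → ℝ → Set ℝ) (ρ S : ℝ) : Prop where
  one_le : 1 ≤ ρ
  swap₁₂ : ∀ x y z t, F x y z t = F y x z t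
  swap₂₃ : ∀ x y z t, F x y z t = F x z y t
  resp : ∀ y z t, Responsive fun x => F x y z t
  near_pair : ∀ x y z t, ∃ v ∈ F x y z t, |v - x| ≤ ρ * |y - z|
  near_self : ∀ x z t, x ∈ F x x z t
  near_last : ∀ x y z t, ∃ v ∈ F x y z t, |v - t| ≤ ρ * |y - z|
  three : ∀ x y z t u₁ u₂ u₃ u₄, |x| ≤ 9 * S → |y| ≤ 9 * S → |z| ≤ 9 * S → |t| ≤ 9 * S →
    u₁ ∈ F x y z t → u₂ ∈ F x y z t → u₃ ∈ F x y z t → u₄ ∈ F x y z t →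
    |u₁| ≤ 9 * S → |u₂| ≤ 9 * S → |u₃| ≤ 9 * S → |u₄| ≤ 9 * S →
    u₁ < u₂ → u₂ < u₃ → u₃ < u₄ → False

namespace ThreeAndOne

variable {F : ℝ → ℝ → ℝ → ℝ → Set ℝ} {ρ S : ℝ}

/-- As long as the three agents stay together, far from the fourth location, they have to share two
facilities. -/
theorem threeAgents (h : ThreeAndOne F ρ S) {a t R : ℝ} (hR : 0 < R) (ha : -S ≤ a) (ht : t ≤ S)
    (hat : (2 * ρ + 4) * R ≤ t - a) :
    ThreeAgents (fun x y z => {v | v + a ∈ F (x + a) (y + a) (z + a) t}) ρ R where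
  one_le := h.one_le
  swap₁₂ x y z := by rw [h.swap₁₂]
  swap₂₃ x y z := by rw [h.swap₂₃]
  resp y z := by
    have hr := h.resp (y + a) (z + a) t
    refine ⟨fun x => ?_, fun x => ?_, fun x x' w hw => ?_⟩
    · exact (hr.finite (x + a)).preimage (add_left_injective a).injOn
    · obtain ⟨v, hv⟩ := hr.nonempty (x + a)
      exact ⟨v - a, by simpa using hv⟩
    · obtain ⟨v, hv, hvw⟩ := hr.sp (x + a) (x' + a) (w + a) hw
      refine ⟨v - a, by simpa using hv, ?_⟩
      convert hvw using 2 <;> ring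
  near_pair x y z := by
    obtain ⟨v, hv, hvx⟩ := h.near_pair (x + a) (y + a) (z + a) t
    refine ⟨v - a, by simpa using hv, ?_⟩
    convert hvx using 2
    · ring
    · congr 1; ring
  near_self x z := h.near_self (x + a) (z + a) t
  two x y z u v w hx hy hz hu hv hw hu' hv' hw' huv hvw := by
    -- The facility for `t` lies beyond `a + 3 * R`, hence is a fourth one besides `u, v, w`.
    obtain ⟨s, hs, hst⟩ := h.near_last (x + a) (y + a) (z + a) t
    have hρ := h.one_le
    rw [abs_le] at hx hy hz hu' hv' hw'
    have h1 : |y + a - (z + a)| ≤ 2 * R := abs_le.2 ⟨by linarith, by linarith⟩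
    have h2 : ρ * |y + a - (z + a)| ≤ 2 * (ρ * R) := by nlinarith
    have h3 : R ≤ ρ * R := by nlinarith
    have h4 := abs_le.1 (hst.trans h2)
    exact h.three (x + a) (y + a) (z + a) t (u + a) (v + a) (w + a) s
      (abs_le.2 ⟨by linarith, by linarith⟩) (abs_le.2 ⟨by linarith, by linarith⟩)
      (abs_le.2 ⟨by linarith, by linarith⟩) (abs_le.2 ⟨by linarith, by linarith⟩) hu hv hw hs
      (abs_le.2 ⟨by linarith, by linarith⟩) (abs_le.2 ⟨by linarith, by linarith⟩)
      (abs_le.2 ⟨by linarith, by linarith⟩) (abs_le.2 ⟨by linarith, by linarith⟩)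
      (by linarith) (by linarith) (by linarith)

theorem not_left_mem_of_far (h : ThreeAndOne F ρ S) {a b c t : ℝ} (ha : -S ≤ a) (ht : t ≤ S)
    (hbc : b < c) (hc : (ρ + 2) * (c - b) < b - a)
    (hat : (2 * ρ + 4) * (2 * (ρ + 4) ^ 3) * (b - a) ≤ t - a) : b ∉ F a b c t := by
  intro hb
  have hρ := h.one_le
  have hba : 0 < b - a := by nlinarith
  have h2 := h.threeAgents (R := 2 * (ρ + 4) ^ 3 * (b - a)) (by positivity) ha ht (by linarith)
  exact h2.not_left_mem (p := b - a) (c := c - a) hba (by linarith) (by linarith) le_rfl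
    (by simpa using hb)

theorem pairMech (h : ThreeAndOne F ρ S) {a t : ℝ} (ha : -S ≤ a) (ht : t ≤ S) :
    PairMech (fun x y => F a x y t)
      fun x y => (ρ + 2) * (y - x) < x - a ∧ (ρ + 2) * (y - x) < t - y where
  symm x y := h.swap₂₃ a x y t
  resp y := by
    have := h.resp a y t
    simpa only [h.swap₁₂ _ a] using this
  diag x := by
    rw [h.swap₁₂, h.swap₂₃]
    exact h.near_self x a t
  mono := by
    rintro x y x' y' ⟨h1, h2⟩ hx hxy hy
    have := h.one_le
    exact ⟨by nlinarith, by nlinarith⟩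
  uniq := by
    rintro x y u v ⟨h1, h2⟩ hxy hu hv hu1 hu2 hv1 hv2
    have hρ := h.one_le
    have h3 : 0 < ρ * (y - x) := by nlinarith
    have h4 : ρ * |x - y| = ρ * (y - x) := by rw [abs_sub_comm, abs_of_pos (by linarith)]
    obtain ⟨w, hw, hwa⟩ := h.near_pair a x y t
    obtain ⟨s, hs, hst⟩ := h.near_last a x y t
    rw [h4, abs_le] at hwa hst
    have T := fun u₂ u₃ hu₂ hu₃ => h.three a x y t w u₂ u₃ s (abs_le.2 ⟨by linarith, by linarith⟩)
      (abs_le.2 ⟨by linarith, by linarith⟩) (abs_le.2 ⟨by linarith, by linarith⟩)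
      (abs_le.2 ⟨by linarith, by linarith⟩) hw hu₂ hu₃ hs (abs_le.2 ⟨by linarith, by linarith⟩)
    rcases lt_trichotomy u v with hlt | heq | hgt
    · exact (T u v hu hv (abs_le.2 ⟨by linarith, by linarith⟩)
        (abs_le.2 ⟨by linarith, by linarith⟩) (abs_le.2 ⟨by linarith, by linarith⟩)
        (by linarith) hlt (by linarith)).elim
    · exact heq
    · exact (T v u hv hu (abs_le.2 ⟨by linarith, by linarith⟩)
        (abs_le.2 ⟨by linarith, by linarith⟩) (abs_le.2 ⟨by linarith, by linarith⟩)
        (by linarith) hgt (by linarith)).elim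

/-- A tight pair between two other locations is not served at its left end. -/
theorem not_left_mem (h : ThreeAndOne F ρ S) {a b c t : ℝ} (ha : -S ≤ a) (ht : t ≤ S)
    (hbc : b < c) (hab : (ρ + 2) * (c - b) < b - a) (hct : (ρ + 2) * (c - b) < t - c) :
    b ∉ F a b c t := by
  intro hb
  have hρ := h.one_le
  have hP := h.pairMech ha ht
  set M : ℝ := (2 * ρ + 4) * (2 * (ρ + 4) ^ 3) with hM
  have hM0 : 0 < M := by positivity
  set T : Set ℝ := {x | ∃ c, x < c ∧ ((ρ + 2) * (c - x) < x - a ∧ (ρ + 2) * (c - x) < t - c) ∧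
    x ∈ F a x c t} with hT
  have hbT : b ∈ T := ⟨c, hbc, ⟨hab, hct⟩, hb⟩
  -- Left ends closer to `a` see `t` as very far, where the two-facility argument already excludes
  -- them; hence the infimum `q` exceeds `a`.
  have hlow : ∀ x ∈ T, a + (t - a) / M ≤ x := by
    rintro x ⟨c, hxc, ⟨h1, h2⟩, hx⟩
    by_contra hlt
    rw [not_le] at hlt
    have h3 : M * (x - a) ≤ t - a := by
      have h4 : x - a < (t - a) / M := by linarith
      rw [lt_div_iff₀ hM0] at h4
      linarith
    exact h.not_left_mem_of_far ha ht hxc h1 h3 hx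
  set q := sInf T with hq
  have hbdd : BddBelow T := ⟨_, fun x hx => hlow x hx⟩
  have hqT : ∀ x ∈ T, q ≤ x := fun x hx => csInf_le hbdd hx
  have hct' : 0 < (ρ + 2) * (c - b) := by nlinarith
  have hqb : q ≤ b := hqT b hbT
  have haq : a < q := by
    have h1 : a + (t - a) / M ≤ q := le_csInf ⟨b, hbT⟩ hlow
    have h2 : 0 < (t - a) / M := div_pos (by linarith) hM0
    linarith
  have hqt : q < t := by linarith
  have hqmem : ∀ {c'}, q < c' → (ρ + 2) * (c' - q) < q - a → (ρ + 2) * (c' - q) < t - c' →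
      q ∈ F a q c' t := by
    intro c' hqc h1 h2
    obtain ⟨v, hv, -, hmin⟩ := (hP.resp c').exists_nearest q
    by_contra hne
    have hvq : 0 < |v - q| := abs_pos.2 (sub_ne_zero.2 fun e => hne (e ▸ hv))
    obtain ⟨x, hxT, hx⟩ := exists_lt_of_csInf_lt ⟨b, hbT⟩
      (lt_min (lt_add_of_pos_right q hvq) hqc)
    rw [lt_min_iff] at hx
    have hqx := hqT x hxT
    obtain ⟨c, hxc, hτ, hxm⟩ := hxT
    have := hP.left_mem_of_left_mem hxc hτ hx.2 (hP.mono ⟨h1, h2⟩ hqx hx.2 le_rfl) hxm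
    have h3 := hmin x this
    rw [abs_of_nonneg (by linarith : 0 ≤ x - q)] at h3
    linarith
  -- `ε` is small enough that `t` is very far at scale `ε` and `q - ε, q + δ` is tight; `δ` makes
  -- `q, q + δ` tight as seen from `q - ε`.
  obtain ⟨ε, hε, hε1, hε2⟩ : ∃ ε, 0 < ε ∧ (2 * ρ + 6 + M) * ε < q - a ∧
      (2 * ρ + 6 + M) * ε < t - q := by
    have h1 : 0 < min (q - a) (t - q) / (2 * ρ + 6 + M) :=
      div_pos (lt_min (by linarith) (by linarith)) (by positivity)
    obtain ⟨ε, h2, h3⟩ := exists_between h1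
    rw [lt_div_iff₀ (by positivity), lt_min_iff] at h3
    exact ⟨ε, h2, by linarith, by linarith⟩
  obtain ⟨δ, hδ, hδε⟩ : ∃ δ, 0 < δ ∧ (ρ + 3) * δ < ε := by
    refine ⟨ε / (ρ + 4), by positivity, ?_⟩
    rw [mul_div_assoc', div_lt_iff₀ (by positivity)]
    nlinarith
  have hρδ : 0 < ρ * δ := by positivity
  have hρε : 0 < ρ * ε := by positivity
  have hMε : 0 < M * ε := by positivity
  have hKδ : (ρ + 2) * δ < ε := by linarith
  have hτ1 : (ρ + 2) * ((q + δ) - (q - ε)) < (q - ε) - a := by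
    have : (ρ + 2) * ((q + δ) - (q - ε)) = (ρ + 2) * δ + (ρ + 2) * ε := by ring
    linarith
  have hτ2 : (ρ + 2) * ((q + δ) - (q - ε)) < t - (q + δ) := by
    have : (ρ + 2) * ((q + δ) - (q - ε)) = (ρ + 2) * δ + (ρ + 2) * ε := by ring
    linarith
  have hqq : q ∈ F a q (q + δ) t := by
    refine hqmem (by linarith) ?_ ?_ <;> rw [add_sub_cancel_left] <;> linarith
  -- The pair's facility cannot lie left of `q`, where no left end is served, and need not lie right
  -- of `q`, since `q` is an image point.
  have hqb' : q ∈ F a (q - ε) (q + δ) t := by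
    obtain ⟨y, hy, hby, hyc⟩ := hP.exists_mem_Icc (by linarith : q - ε < q + δ) ⟨hτ1, hτ2⟩
    obtain ⟨v, hv, hvI, hmin⟩ := (hP.resp (q + δ)).exists_nearest (q - ε)
    have h1 := hmin q hqq
    have h2 := hmin y ((hP.resp (q + δ)).mem_self hy)
    rw [abs_of_pos (by linarith : 0 < q - (q - ε)), abs_le] at h1
    rw [abs_of_nonneg (by linarith : 0 ≤ y - (q - ε)), abs_le] at h2
    have hvy : v = y := hP.uniq ⟨hτ1, hτ2⟩ (by linarith) hv hy (by linarith) (by linarith)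
      (by linarith) (by linarith)
    have hvq : q ≤ v := by
      by_contra hlt
      rw [not_le] at hlt
      have h3 := hP.mono (x' := v) ⟨hτ1, hτ2⟩ (by linarith) (by linarith) le_rfl
      exact absurd (hqT v ⟨q + δ, by linarith, h3, hvI⟩) (not_le.2 hlt)
    have : v = q := le_antisymm (by linarith) hvq
    exact this ▸ hv
  -- The agent at `a` moves onto `q`, so `q - ε` takes over the role of `a` in the far case.
  have hqs : q ∈ F (q - ε) q (q + δ) t := by
    rw [h.swap₁₂]
    exact (h.resp (q - ε) (q + δ) t).mem_self hqb'
  refine h.not_left_mem_of_far (by linarith) ht (by linarith) ?_ ?_ hqs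
  · rw [add_sub_cancel_left]; linarith
  · rw [sub_sub_cancel]; linarith

/-- A tight pair between two other locations is served at its right end. -/
theorem right_mem (h : ThreeAndOne F ρ S) {a b c t : ℝ} (ha : -S ≤ a) (ht : t ≤ S)
    (hbc : b < c) (hab : (ρ + 2) * (c - b) < b - a) (hct : (ρ + 2) * (c - b) < t - c) :
    c ∈ F a b c t := by
  have hP := h.pairMech ha ht
  obtain ⟨y, hy, hby, hyc⟩ := hP.exists_mem_Icc hbc ⟨hab, hct⟩
  rcases hyc.eq_or_lt with rfl | hlt
  · exact hy
  · obtain ⟨h1, h2⟩ := hP.mono (x' := y) ⟨hab, hct⟩ hby hlt le_rfl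
    exact (h.not_left_mem ha ht hlt h1 h2 ((hP.resp c).mem_self hy)).elim

end ThreeAndOne

/-! ### Bounded rules, clusters and the contradiction -/

/-- An anonymous strategyproof rule that serves every agent within `ρ` times the optimal maximum
cost, described by the set of its `k` facilities. -/
structure BoundedRule (n k : ℕ) (φ : (Fin n → ℝ) → Set ℝ) (ρ : ℝ) : Prop where
  one_le : 1 ≤ ρ
  finite : ∀ x, (φ x).Finite
  ncard_le : ∀ x, (φ x).ncard ≤ k
  nonempty : ∀ x, (φ x).Nonempty
  anonymous : ∀ x (σ : Equiv.Perm (Fin n)), φ (x ∘ σ) = φ x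
  sp : ∀ x i s, ∀ w ∈ φ (Function.update x i s), ∃ v ∈ φ x, |v - x i| ≤ |w - x i|
  near : ∀ x (Y : Fin k → ℝ) (δ : ℝ), (∀ i, ∃ l, |Y l - x i| ≤ δ) →
    ∀ i, ∃ v ∈ φ x, |v - x i| ≤ ρ * δ

/-- One agent at `x`, one at `y`, `i` agents at `z`, `m + 1 - i` agents at `t`, and the other agents
alone at remote locations. -/
def clusterProfile (n m : ℕ) (T : ℝ) (i : ℕ) (x y z t : ℝ) : Fin n → ℝ := fun j =>
  if j.val = 0 then x else if j.val = 1 then y else if j.val < 2 + i then z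
  else if j.val < 3 + m then t else T * j.val

namespace BoundedRule

variable {n k m : ℕ} {φ : (Fin n → ℝ) → Set ℝ} {ρ : ℝ}

theorem responsive (h : BoundedRule n k φ ρ) (x : Fin n → ℝ) (i : Fin n) :
    Responsive fun s => φ (Function.update x i s) where
  finite s := h.finite _
  nonempty s := h.nonempty _
  sp s s' w hw := by
    have := h.sp (Function.update x i s) i s' w (by simpa using hw)
    simpa using this

theorem near_clusterProfile (h : BoundedRule n k φ ρ) (hk : 3 ≤ k) (hn : n = k + m) (T : ℝ) (i : ℕ)
    {x y z t p₁ p₂ p₃ δ : ℝ} (hδ : 0 ≤ δ)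
    (hx : |p₁ - x| ≤ δ ∨ |p₂ - x| ≤ δ ∨ |p₃ - x| ≤ δ)
    (hy : |p₁ - y| ≤ δ ∨ |p₂ - y| ≤ δ ∨ |p₃ - y| ≤ δ)
    (hz : |p₁ - z| ≤ δ ∨ |p₂ - z| ≤ δ ∨ |p₃ - z| ≤ δ)
    (ht : |p₁ - t| ≤ δ ∨ |p₂ - t| ≤ δ ∨ |p₃ - t| ≤ δ) (j : Fin n) :
    ∃ v ∈ φ (clusterProfile n m T i x y z t), |v - clusterProfile n m T i x y z t j| ≤ ρ * δ := by
  refine h.near _ (fun l => if l.val = 0 then p₁ else if l.val = 1 then p₂ else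
    if l.val = 2 then p₃ else T * (l.val + m : ℕ)) δ (fun j => ?_) j
  have local_case : ∀ q, (|p₁ - q| ≤ δ ∨ |p₂ - q| ≤ δ ∨ |p₃ - q| ≤ δ) → ∃ l : Fin k,
      |(if l.val = 0 then p₁ else if l.val = 1 then p₂ else
        if l.val = 2 then p₃ else T * (l.val + m : ℕ)) - q| ≤ δ := by
    rintro q (hq | hq | hq)
    · exact ⟨⟨0, by omega⟩, by simpa using hq⟩
    · exact ⟨⟨1, by omega⟩, by simpa using hq⟩
    · exact ⟨⟨2, by omega⟩, by simpa using hq⟩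
  unfold clusterProfile
  split_ifs with h0 h1 h2 h3
  · exact local_case x hx
  · exact local_case y hy
  · exact local_case z hz
  · exact local_case t ht
  · have hj := j.isLt
    refine ⟨⟨j.val - m, by omega⟩, ?_⟩
    have e0 : ¬ j.val - m = 0 := by omega
    have e1 : ¬ j.val - m = 1 := by omega
    have e2 : ¬ j.val - m = 2 := by omega
    have e3 : j.val - m + m = j.val := by omega
    simpa [e0, e1, e2, e3] using hδ

/-- The remote agents leave at most three facilities for the window `[-W, W]`. -/
theorem three_of_window (h : BoundedRule n k φ ρ) (hk : 3 ≤ k) (hn : n = k + m) {W : ℝ}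
    (hW : 0 < W) (i : ℕ) (hi : i ≤ m) {x y z t u₁ u₂ u₃ u₄ : ℝ} (hx : |x| ≤ W) (ht : |t| ≤ W)
    (hm₁ : u₁ ∈ φ (clusterProfile n m (6 * ρ * W) i x y z t))
    (hm₂ : u₂ ∈ φ (clusterProfile n m (6 * ρ * W) i x y z t))
    (hm₃ : u₃ ∈ φ (clusterProfile n m (6 * ρ * W) i x y z t))
    (hm₄ : u₄ ∈ φ (clusterProfile n m (6 * ρ * W) i x y z t))
    (hu₁ : |u₁| ≤ W) (hu₂ : |u₂| ≤ W) (hu₃ : |u₃| ≤ W) (hu₄ : |u₄| ≤ W)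
    (h₁₂ : u₁ < u₂) (h₂₃ : u₂ < u₃) (h₃₄ : u₃ < u₄) : False := by
  have hρ := h.one_le
  set θ := clusterProfile n m (6 * ρ * W) i x y z t with hθ
  rw [abs_le] at hx ht
  have hρW : W ≤ ρ * W := by nlinarith
  have hremote : ∀ r : Fin (k - 3), ∃ v ∈ φ θ,
      |v - 6 * ρ * W * (3 + m + r.val : ℕ)| ≤ ρ * (2 * W) := by
    intro r
    have hr := r.isLt
    have hlt : 3 + m + r.val < n := by omega
    -- Points of the window are within `2 * W` of each other, so remote agents have facilities
    -- within `2 * ρ * W`; the spacing `6 * ρ * W` keeps these distinct and outside the window.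
    have := h.near_clusterProfile hk hn (6 * ρ * W) i (x := x) (y := y) (z := z) (t := t)
      (p₁ := x) (p₂ := y) (p₃ := z) (δ := 2 * W) (by linarith)
      (Or.inl (by simp; linarith)) (Or.inr (Or.inl (by simp; linarith)))
      (Or.inr (Or.inr (by simp; linarith)))
      (Or.inl (abs_le.2 ⟨by linarith, by linarith⟩)) ⟨3 + m + r.val, hlt⟩
    have e : clusterProfile n m (6 * ρ * W) i x y z t ⟨3 + m + r.val, hlt⟩ =
        6 * ρ * W * (3 + m + r.val : ℕ) := by
      unfold clusterProfile
      rw [if_neg (by change ¬ 3 + m + r.val = 0; omega),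
        if_neg (by change ¬ 3 + m + r.val = 1; omega),
        if_neg (by change ¬ 3 + m + r.val < 2 + i; omega),
        if_neg (by change ¬ 3 + m + r.val < 3 + m; omega)]
    rwa [e] at this
  choose v hv hvr using hremote
  have hvW : ∀ r, W < v r := by
    intro r
    have h1 := (abs_le.1 (hvr r)).1
    have h2 : (3 : ℝ) ≤ (3 + m + r.val : ℕ) := by
      push_cast
      have : (0 : ℝ) ≤ m := Nat.cast_nonneg _
      have : (0 : ℝ) ≤ r.val := Nat.cast_nonneg _
      linarith
    nlinarith
  have hlt : ∀ r s, r < s → v r < v s := by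
    intro r s hrs
    have h1 := (abs_le.1 (hvr r)).2
    have h2 := (abs_le.1 (hvr s)).1
    have h3 : ((3 + m + r.val : ℕ) : ℝ) + 1 ≤ (3 + m + s.val : ℕ) := by
      have : 3 + m + r.val + 1 ≤ 3 + m + s.val := by
        have : r.val < s.val := hrs
        omega
      exact_mod_cast this
    nlinarith
  have hinj : Function.Injective v := StrictMono.injective fun r s => hlt r s
  have hdisj : Disjoint ({u₁, u₂, u₃, u₄} : Finset ℝ) (Finset.univ.image v) := by
    rw [Finset.disjoint_left]
    intro u hu hu'
    obtain ⟨r, -, rfl⟩ := Finset.mem_image.1 hu'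
    have := hvW r
    rw [abs_le] at hu₁ hu₂ hu₃ hu₄
    simp only [Finset.mem_insert, Finset.mem_singleton] at hu
    rcases hu with e | e | e | e <;> linarith
  have hcard4 : ({u₁, u₂, u₃, u₄} : Finset ℝ).card = 4 := by
    rw [Finset.card_insert_of_notMem, Finset.card_insert_of_notMem, Finset.card_insert_of_notMem,
      Finset.card_singleton]
    · simpa using h₃₄.ne
    · simpa using ⟨h₂₃.ne, (h₂₃.trans h₃₄).ne⟩
    · simpa using ⟨h₁₂.ne, (h₁₂.trans h₂₃).ne, (h₁₂.trans (h₂₃.trans h₃₄)).ne⟩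
  have hcard : (({u₁, u₂, u₃, u₄} : Finset ℝ) ∪ Finset.univ.image v).card = 4 + (k - 3) := by
    rw [Finset.card_union_of_disjoint hdisj, hcard4, Finset.card_image_of_injective _ hinj,
      Finset.card_univ, Fintype.card_fin]
  have hsub : ((({u₁, u₂, u₃, u₄} : Finset ℝ) ∪ Finset.univ.image v : Finset ℝ) : Set ℝ) ⊆ φ θ := by
    intro u hu
    rw [Finset.mem_coe, Finset.mem_union, Finset.mem_image] at hu
    rcases hu with hu | ⟨r, -, rfl⟩
    · simp only [Finset.mem_insert, Finset.mem_singleton] at hu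
      rcases hu with rfl | rfl | rfl | rfl <;> assumption
    · exact hv r
  have h1 := Set.ncard_le_ncard hsub (h.finite θ)
  rw [Set.ncard_coe_finset, hcard] at h1
  have := h.ncard_le θ
  omega

theorem near_fst (h : BoundedRule n k φ ρ) (hk : 3 ≤ k) (hn : n = k + m) (T : ℝ) (i : ℕ)
    (x y z t : ℝ) : ∃ v ∈ φ (clusterProfile n m T i x y z t), |v - x| ≤ ρ * |y - z| := by
  have := h.near_clusterProfile hk hn T i (x := x) (y := y) (z := z) (t := t)
    (p₁ := x) (p₂ := y) (p₃ := t) (abs_nonneg (y - z)) (by simp) (by simp) (by simp) (by simp)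
    ⟨0, by omega⟩
  simpa [clusterProfile] using this

theorem near_lst (h : BoundedRule n k φ ρ) (hk : 3 ≤ k) (hn : n = k + m) (hm : 1 ≤ m) (T : ℝ)
    {i : ℕ} (hi : i ≤ m) (x y z t : ℝ) :
    ∃ v ∈ φ (clusterProfile n m T i x y z t), |v - t| ≤ ρ * |y - z| := by
  have := h.near_clusterProfile hk hn T i (x := x) (y := y) (z := z) (t := t)
    (p₁ := x) (p₂ := y) (p₃ := t) (abs_nonneg (y - z)) (by simp) (by simp) (by simp) (by simp)
    ⟨2 + m, by omega⟩
  have e : ¬ 2 + m = 1 := by omega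
  have e2 : ¬ m < i := by omega
  simpa [clusterProfile, e, e2] using this

theorem threeAndOne (h : BoundedRule n k φ ρ) (hk : 3 ≤ k) (hn : n = k + m) (hm : 1 ≤ m) {S : ℝ}
    (hS : 0 < S) :
    ThreeAndOne (fun x y z t => φ (clusterProfile n m (6 * ρ * (9 * S)) 1 x y z t)) ρ S where
  one_le := h.one_le
  swap₁₂ x y z t := by
    rw [← h.anonymous _ (Equiv.swap (⟨0, by omega⟩ : Fin n) ⟨1, by omega⟩)]
    congr 1
    funext j
    by_cases h0 : j = ⟨0, by omega⟩
    · subst h0; simp [clusterProfile]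
    by_cases h1 : j = ⟨1, by omega⟩
    · subst h1; simp [clusterProfile]
    rw [Function.comp_apply, Equiv.swap_apply_of_ne_of_ne h0 h1]
    rw [Fin.ext_iff] at h0 h1
    simp only at h0 h1
    simp [clusterProfile, h0, h1]
  swap₂₃ x y z t := by
    rw [← h.anonymous _ (Equiv.swap (⟨1, by omega⟩ : Fin n) ⟨2, by omega⟩)]
    congr 1
    funext j
    by_cases h0 : j = ⟨1, by omega⟩
    · subst h0; simp [clusterProfile]
    by_cases h1 : j = ⟨2, by omega⟩
    · subst h1; simp [clusterProfile]
    rw [Function.comp_apply, Equiv.swap_apply_of_ne_of_ne h0 h1]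
    rw [Fin.ext_iff] at h0 h1
    simp only at h0 h1
    have h2 : ¬ j.val < 3 ∨ j.val = 0 := by omega
    rcases h2 with h2 | h2 <;> simp [clusterProfile, h0, h2]
  resp y z t := by
    have := h.responsive (clusterProfile n m (6 * ρ * (9 * S)) 1 0 y z t) ⟨0, by omega⟩
    convert this using 3 with x
    funext j
    by_cases h0 : j = ⟨0, by omega⟩
    · subst h0; simp [clusterProfile]
    · rw [Function.update_of_ne h0]
      rw [Fin.ext_iff] at h0
      simp only at h0
      simp [clusterProfile, h0]
  near_pair x y z t := h.near_fst hk hn _ 1 x y z t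
  near_self x z t := by
    have := h.near_clusterProfile hk hn (6 * ρ * (9 * S)) 1 (x := x) (y := x) (z := z) (t := t)
      (p₁ := x) (p₂ := z) (p₃ := t) le_rfl (by simp) (by simp) (by simp) (by simp)
      ⟨0, by omega⟩
    obtain ⟨v, hv, hvx⟩ := this
    have : v = x := by simpa [clusterProfile, sub_eq_zero] using hvx
    exact this ▸ hv
  near_last x y z t := h.near_lst hk hn hm _ hm x y z t
  three x y z t u₁ u₂ u₃ u₄ hx _ _ ht h1 h2 h3 h4 h1' h2' h3' h4' :=
    h.three_of_window hk hn (by linarith) 1 hm hx ht h1 h2 h3 h4 h1' h2' h3' h4'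

/-- A cluster at the right end of a tight pair is served, whatever its size. -/
theorem cluster_mem (h : BoundedRule n k φ ρ) (hn : n = k + m) (hk : 3 ≤ k) {T a b c d : ℝ}
    (hc : c ∈ φ (clusterProfile n m T 1 a b c d)) {i : ℕ} (hi1 : 1 ≤ i) :
    i ≤ m → c ∈ φ (clusterProfile n m T i a b c d) := by
  induction i, hi1 using Nat.le_induction with
  | base => exact fun _ => hc
  | succ i hi1 ih =>
    intro hi
    have e : clusterProfile n m T i a b c d =
        Function.update (clusterProfile n m T (i + 1) a b c d) ⟨2 + i, by omega⟩ d := by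
      funext j
      by_cases h0 : j = ⟨2 + i, by omega⟩
      · subst h0
        have e1 : ¬ 2 + i = 1 := by omega
        have e2 : 2 + i < 3 + m := by omega
        simp [clusterProfile, e1, e2]
      · rw [Function.update_of_ne h0]
        rw [Fin.ext_iff] at h0
        simp only at h0
        have e1 : j.val < 2 + (i + 1) ↔ j.val < 2 + i := by omega
        simp only [clusterProfile, e1]
    have h1 := ih (by omega)
    rw [e] at h1
    obtain ⟨v, hv, hvc⟩ := h.sp _ _ _ c h1
    have e2 : clusterProfile n m T (i + 1) a b c d ⟨2 + i, by omega⟩ = c := by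
      have e1 : ¬ 2 + i = 1 := by omega
      have e3 : 2 + i < 2 + (i + 1) := by omega
      simp [clusterProfile, e1, e3]
    rw [e2] at hvc
    have : v = c := by simpa [sub_eq_zero] using hvc
    exact this ▸ hv

theorem not_boundedRule (hk : 3 ≤ k) (hn : n = k + m) (hm : 1 ≤ m) : ¬ BoundedRule n k φ ρ := by
  intro h
  have hρ := h.one_le
  obtain ⟨S, hS⟩ : ∃ S : ℝ, S = 2 * ρ + 5 := ⟨_, rfl⟩
  have hS0 : 0 < S := by linarith
  have hF := h.threeAndOne hk hn hm hS0
  set T : ℝ := 6 * ρ * (9 * S) with hT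
  set c : ℝ := 2 * ρ + 4 with hc
  have htight : ∀ {b}, c - b < 1 / (ρ + 2) → (ρ + 2) * (c - b) < 1 := by
    intro b hb
    rw [lt_div_iff₀ (by linarith)] at hb
    linarith
  have hinv : 1 / (ρ + 2) < 1 := by
    rw [div_lt_one (by linarith)]
    linarith
  have hinv0 : 0 < 1 / (ρ + 2) := by positivity
  have hright : ∀ b, b < c → c - b < 1 / (ρ + 2) → c ∈ φ (clusterProfile n m T m 0 b c (c + 1)) := by
    intro b hb hcb
    have := htight hcb
    refine h.cluster_mem hn hk ?_ hm le_rfl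
    exact hF.right_mem (by linarith) (by linarith) hb (by linarith) (by linarith)
  have hΦ : Responsive fun b => φ (clusterProfile n m T m 0 b c (c + 1)) := by
    have := h.responsive (clusterProfile n m T m 0 0 c (c + 1)) ⟨1, by omega⟩
    convert this using 3 with x
    funext j
    by_cases h0 : j = ⟨1, by omega⟩
    · subst h0; simp [clusterProfile]
    · rw [Function.update_of_ne h0]
      rw [Fin.ext_iff] at h0
      simp only at h0
      simp [clusterProfile, h0]
  obtain ⟨b₀, hb₀, hb₀c⟩ := exists_between (sub_lt_self c hinv0)
  have hcI : c ∈ φ (clusterProfile n m T m 0 c c (c + 1)) :=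
    hΦ.mem_self (hright b₀ hb₀c (by linarith))
  have hb₀I : b₀ ∉ φ (clusterProfile n m T m 0 b₀ c (c + 1)) := by
    intro hb
    have h1 := htight (b := b₀) (by linarith)
    have h2 := hright b₀ hb₀c (by linarith)
    obtain ⟨v, hv, hv0⟩ := h.near_fst hk hn T m 0 b₀ c (c + 1)
    obtain ⟨s, hs, hst⟩ := h.near_lst hk hn hm T le_rfl 0 b₀ c (c + 1)
    rw [abs_sub_comm b₀ c, abs_of_pos (by linarith : 0 < c - b₀), abs_le] at hv0 hst
    refine h.three_of_window hk hn (W := 9 * S) (by linarith) m le_rfl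
      (abs_le.2 ⟨by linarith, by linarith⟩) (abs_le.2 ⟨by linarith, by linarith⟩) hv hb h2 hs
      (abs_le.2 ⟨by linarith, by linarith⟩) (abs_le.2 ⟨by linarith, by linarith⟩)
      (abs_le.2 ⟨by linarith, by linarith⟩) (abs_le.2 ⟨by linarith, by linarith⟩)
      (by linarith) hb₀c (by linarith)
  -- One facility at `c` serves both `c` and `c + 1` within `1`, so an agent at `c - ρ - 1` has a
  -- facility within `ρ`: an image point in `[3, c - 1]`, to the left of `b₀`.
  obtain ⟨v, hv, hvb⟩ := h.near_clusterProfile hk hn T m (x := 0) (y := c - ρ - 1) (z := c)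
    (t := c + 1) (p₁ := 0) (p₂ := c - ρ - 1) (p₃ := c) (δ := 1) zero_le_one (by simp) (by simp)
    (by simp) (by simp) ⟨1, by omega⟩
  have hvb' : |v - (c - ρ - 1)| ≤ ρ := by simpa [clusterProfile] using hvb
  rw [abs_le] at hvb'
  obtain ⟨l, r, hvl, hlb, hbr, hrc, -, hL, -⟩ :=
    hΦ.exists_hole (hΦ.mem_self hv) hcI hb₀I (by linarith) hb₀c.le
  obtain ⟨η, hη, hη1⟩ := exists_between hinv0
  obtain ⟨b, hlb', hb⟩ := exists_between (lt_min (lt_min (by linarith : l < (l + r) / 2) hlb)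
    (lt_add_of_pos_right l (mul_pos hη (by linarith : 0 < c - b₀))))
  rw [lt_min_iff, lt_min_iff] at hb
  have hl1 := hL b hlb' (by linarith)
  -- The last agent moves from `c + 1` onto the facility `l`; relabelling then shows agents `0, l,
  -- b` facing the cluster at `c`.
  have hl2 : l ∈ φ (clusterProfile n m T m 0 b c l) := by
    have e : ∀ t, clusterProfile n m T m 0 b c t =
        Function.update (clusterProfile n m T m 0 b c 0) ⟨2 + m, by omega⟩ t := by
      intro t
      funext j
      by_cases h0 : j = ⟨2 + m, by omega⟩
      · subst h0
        have e1 : ¬ 2 + m = 1 := by omega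
        simp [clusterProfile, e1]
      · rw [Function.update_of_ne h0]
        rw [Fin.ext_iff] at h0
        simp only at h0
        have e1 : j.val < 3 + m ↔ j.val < 2 + m := by omega
        simp only [clusterProfile, e1]
        split_ifs <;> rfl
    rw [e] at hl1 ⊢
    exact (h.responsive _ _).mem_self hl1
  have hl3 : l ∈ φ (clusterProfile n m T 1 0 b l c) := by
    rw [← h.anonymous _ (Equiv.swap (⟨2, by omega⟩ : Fin n) ⟨2 + m, by omega⟩)]
    convert hl2 using 2
    funext j
    by_cases h0 : j = ⟨2, by omega⟩
    · subst h0
      have e1 : ¬ 2 + m = 1 := by omega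
      have e2 : m ≠ 0 := by omega
      have e3 : ¬ 2 + m < 3 := by omega
      have e4 : 0 < m := by omega
      simp [clusterProfile, e1, e2, e3, e4]
    by_cases h1 : j = ⟨2 + m, by omega⟩
    · subst h1
      have e1 : ¬ 2 + m = 1 := by omega
      simp [clusterProfile, e1]
    rw [Function.comp_apply, Equiv.swap_apply_of_ne_of_ne h0 h1]
    rw [Fin.ext_iff] at h0 h1
    simp only at h0 h1
    have e1 : j.val < 2 + m ↔ j.val < 3 + m := by omega
    simp only [clusterProfile, e1]
    split_ifs <;> first | rfl | omega
  have hl4 : l ∈ φ (clusterProfile n m T 1 0 l b c) := by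
    have := hF.swap₂₃ 0 b l c
    rwa [this] at hl3
  have hηρ : (ρ + 2) * η < 1 := by
    rw [lt_div_iff₀ (by linarith)] at hη1
    linarith
  have hcb0 : (ρ + 2) * (b - l) < c - b₀ := by
    have h1 : (ρ + 2) * (b - l) < (ρ + 2) * (η * (c - b₀)) := by
      apply mul_lt_mul_of_pos_left <;> linarith
    have h2 : (ρ + 2) * η * (c - b₀) < 1 * (c - b₀) := by
      apply mul_lt_mul_of_pos_right <;> linarith
    linarith
  exact hF.not_left_mem (by linarith) (by linarith) hlb' (by linarith) (by linarith) hl4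

end BoundedRule

/-! ### From group effects to bounded rules -/

theorem cost_nonneg {k : ℕ} (Y : Placement k) (x : ℝ) : 0 ≤ cost Y x :=
  Real.iInf_nonneg fun _ => abs_nonneg _

theorem cost_le {k : ℕ} (Y : Placement k) (x : ℝ) (l : Fin k) : cost Y x ≤ |Y l - x| :=
  ciInf_le (Set.finite_range _).bddBelow l

theorem exists_cost_eq {k : ℕ} (hk : 0 < k) (Y : Placement k) (x : ℝ) :
    ∃ l, |Y l - x| = cost Y x := by
  have : Nonempty (Fin k) := ⟨⟨0, hk⟩⟩
  exact exists_eq_ciInf_of_finite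

/-- A finite approximation ratio bounds the effect of the mechanism by a multiple of the effect of
any other placement. -/
theorem exists_mge_le {n m k : ℕ} {E : GroupEffect n m k} {f : Mechanism n m k}
    (hf : approxRatio E f < ⊤) :
    ∃ r : ℝ, 0 ≤ r ∧ ∀ θ Y B, mge E θ Y ≤ B → 0 ≤ B → mge E θ (f θ) ≤ r * B := by
  refine ⟨(approxRatio E f).toReal, ENNReal.toReal_nonneg, fun θ Y B hY hB => ?_⟩
  have h1 : ENNReal.ofReal (mge E θ (f θ)) / (⨅ Y, ENNReal.ofReal (mge E θ Y)) ≤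
      approxRatio E f :=
    le_iSup (fun θ => ENNReal.ofReal (mge E θ (f θ)) / ⨅ Y, ENNReal.ofReal (mge E θ Y)) θ
  have h2 : (⨅ Y, ENNReal.ofReal (mge E θ Y)) ≤ ENNReal.ofReal B :=
    (iInf_le _ Y).trans (ENNReal.ofReal_le_ofReal hY)
  have h3 : ENNReal.ofReal (mge E θ (f θ)) ≤
      approxRatio E f * ⨅ Y, ENNReal.ofReal (mge E θ Y) := by
    rw [ENNReal.div_le_iff_le_mul (Or.inr hf.ne)
      (Or.inl (h2.trans_lt ENNReal.ofReal_lt_top).ne)] at h1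
    exact h1
  have h4 := h3.trans (mul_le_mul_right h2 _)
  rw [← ENNReal.ofReal_toReal hf.ne, ← ENNReal.ofReal_mul ENNReal.toReal_nonneg] at h4
  exact (ENNReal.ofReal_le_ofReal_iff (by positivity)).1 h4

/-- The profile in which everyone belongs to all groups. -/
def fullProfile {n : ℕ} (m : ℕ) (x : Fin n → ℝ) : Profile n m := fun i => ⟨x i, Finset.univ⟩

theorem boundedRule_of_cost_le {n m k : ℕ} (hk : 0 < k) {f : Mechanism n m k} (ha : Anonymous f)
    (hs : Strategyproof f) {ρ : ℝ}
    (hρ : ∀ (x : Fin n → ℝ) (Y : Placement k) (δ : ℝ), 0 ≤ δ → (∀ i, cost Y (x i) ≤ δ) →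
      ∀ i, cost (f (fullProfile m x)) (x i) ≤ ρ * δ) :
    BoundedRule n k (fun x => Set.range (f (fullProfile m x))) (max 1 ρ) where
  one_le := le_max_left _ _
  finite x := Set.finite_range _
  ncard_le x := by
    rw [← Set.image_univ]
    refine (Set.ncard_image_le Set.finite_univ).trans ?_
    simp [Set.ncard_univ]
  nonempty x := ⟨_, ⟨⟨0, hk⟩, rfl⟩⟩
  anonymous x σ := ha (fullProfile m x) σ
  sp x i s w := by
    rintro ⟨l, rfl⟩
    have h1 := hs (fullProfile m x) i s
    have e : Function.update (fullProfile m x) i ⟨s, (fullProfile m x i).groups⟩ =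
        fullProfile m (Function.update x i s) := by
      funext j
      by_cases hj : j = i
      · subst hj; simp [fullProfile]
      · simp [fullProfile, Function.update_of_ne hj]
    rw [e] at h1
    obtain ⟨l', hl'⟩ := exists_cost_eq hk (f (fullProfile m x)) (x i)
    exact ⟨_, ⟨l', rfl⟩, hl'.trans_le (h1.trans (cost_le _ _ l))⟩
  near x Y δ hY i := by
    obtain ⟨l, hl⟩ := hY i
    have hδ : 0 ≤ δ := (abs_nonneg _).trans hl
    have h1 := hρ x Y δ hδ (fun i => (hY i).elim fun l hl => (cost_le Y (x i) l).trans hl) i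
    obtain ⟨l', hl'⟩ := exists_cost_eq hk (f (fullProfile m x)) (x i)
    exact ⟨_, ⟨l', rfl⟩, hl'.trans_le (h1.trans (by gcongr; exact le_max_right _ _))⟩

/-- There is no bounded mechanism for any effect that is equivalent to the maximum cost on the
profiles in which everyone belongs to all groups. -/
theorem not_approxRatio_lt_top {n m k : ℕ} (hk : 3 ≤ k) (hn : k < n) {E : GroupEffect n m k}
    {α β : ℝ} (hα : 0 < α) (hβ : 0 ≤ β)
    (hlow : ∀ (x : Fin n → ℝ) Y i, α * cost Y (x i) ≤ mge E (fullProfile m x) Y)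
    (hup : ∀ (x : Fin n → ℝ) Y δ, 0 ≤ δ → (∀ i, cost Y (x i) ≤ δ) →
      mge E (fullProfile m x) Y ≤ β * δ) :
    ¬ ∃ f : Mechanism n m k, Anonymous f ∧ Strategyproof f ∧ approxRatio E f < ⊤ := by
  rintro ⟨f, ha, hs, hf⟩
  obtain ⟨r, hr, hrf⟩ := exists_mge_le hf
  refine BoundedRule.not_boundedRule hk (m := n - k) (by omega) (by omega)
    (boundedRule_of_cost_le (by omega) ha hs (ρ := r * β / α) fun x Y δ hδ hY i => ?_)
  have h1 := hrf _ Y _ (hup x Y δ hδ hY) (by positivity)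
  have h2 := (hlow x (f (fullProfile m x)) i).trans h1
  rw [div_mul_eq_mul_div, le_div_iff₀ hα]
  linarith

theorem le_mge {n m k : ℕ} (E : GroupEffect n m k) (θ : Profile n m) (Y : Placement k) (j : Fin m) :
    E θ Y j ≤ mge E θ Y :=
  le_ciSup (Set.finite_range _).bddAbove j

end FacilityLocation

open FacilityLocation in
theorem mainTheorem7 (k n m : ℕ) (hk : 3 ≤ k) (hn : k < n)
    (w : Fin m → ℝ) (hw : ∀ j, 0 ≤ w j) (hpos : ∃ j, 0 < w j) :
    (¬ ∃ f : FacilityLocation.Mechanism n m k,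
        FacilityLocation.Anonymous f ∧ FacilityLocation.Strategyproof f ∧
          FacilityLocation.approxRatio (FacilityLocation.wtgc w) f < ⊤) ∧
    (¬ ∃ f : FacilityLocation.Mechanism n m k,
        FacilityLocation.Anonymous f ∧ FacilityLocation.Strategyproof f ∧
          FacilityLocation.approxRatio (FacilityLocation.wmgc w) f < ⊤) := by
  obtain ⟨j₀, hj₀⟩ := hpos
  have : Nonempty (Fin m) := ⟨j₀⟩
  have hsum : ∀ j, w j ≤ ∑ j, w j := fun j =>
    Finset.single_le_sum (fun j _ => hw j) (Finset.mem_univ j)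
  have hsum0 : 0 ≤ ∑ j, w j := Finset.sum_nonneg fun j _ => hw j
  refine ⟨not_approxRatio_lt_top hk hn (α := w j₀) (β := (∑ j, w j) * n) hj₀ (by positivity)
      (fun x Y i => ?_) (fun x Y δ hδ hY => ?_),
    not_approxRatio_lt_top hk hn (α := w j₀) (β := ∑ j, w j) hj₀ hsum0
      (fun x Y i => ?_) (fun x Y δ hδ hY => ?_)⟩
  · refine le_trans ?_ (le_mge _ _ _ j₀)
    refine mul_le_mul_of_nonneg_left ?_ hj₀.le
    exact Finset.single_le_sum (f := fun i => cost Y (fullProfile m x i).loc)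
      (fun i _ => cost_nonneg _ _) (by simp [fullProfile])
  · refine ciSup_le fun j => ?_
    rw [wtgc, mul_assoc]
    refine mul_le_mul (hsum j) ?_ (Finset.sum_nonneg fun i _ => cost_nonneg _ _) hsum0
    refine (Finset.sum_le_card_nsmul _ _ δ fun i _ => hY i).trans ?_
    rw [nsmul_eq_mul]
    gcongr
    exact (Finset.card_le_univ _).trans (by simp)
  · refine le_trans ?_ (le_mge _ _ _ j₀)
    refine mul_le_mul_of_nonneg_left ?_ hj₀.le
    exact le_ciSup (f := fun i : {i : Fin n // j₀ ∈ (fullProfile m x i).groups} =>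
      cost Y (fullProfile m x i.1).loc) (Set.finite_range _).bddAbove ⟨i, by simp [fullProfile]⟩
  · refine ciSup_le fun j => ?_
    refine mul_le_mul (hsum j) (Real.iSup_le (fun i => hY i.1) hδ)
      (Real.iSup_nonneg fun i => cost_nonneg _ _) hsum0
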